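/- Fix $d$ with $0<d<1$. For each $n\ge 1$ let $X=X^{(n)}$ and $Y=Y^{(n)}$ be independent random $n\times n$ matrices on a common probability space (which may depend on $n$), such that the entries $X_{ij}$ are i.i.d. Bernoulli$(d/n)$ random variables, and the entries $Y_{ij}$ are i.i.d. complex-valued (in particular, possibly real-valued) random variables with $\mathbb{E}\,Y_{ij}=0$ and $\mathbb{E}|Y_{ij}|^2=1$. Let $Z=X\odot Y$ be the entrywise product, $Z_{ij}=X_{ij}Y_{ij}$, and let $\rho(Z)$ be its spectral radius, i.e. the maximal modulus of the eigenvalues of $Z$. Then $\rho(Z)=O_{\mathsf p}(1)$; that is, for every function $\phi:\mathbb{N}\to\mathbb{R}$ with $\lim_{n\to\infty}\phi(n)=\infty$, $$\lim_{n\to\infty}\mathbb{P}\big(\rho(Z)\le \phi(n)\big)=1 .$$ -/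

import Mathlib

open MeasureTheory ProbabilityTheory Filter Topology
open scoped Matrix

/-- The events `A n` (each in its own probability space) hold with high probability. -/
def WithHighProbability {Ω : ℕ → Type*} [∀ n, MeasurableSpace (Ω n)]
    (P : ∀ n, Measure (Ω n)) (A : ∀ n, Set (Ω n)) : Prop :=
  Tendsto (fun n => P n (A n)) atTop (𝓝 1)

/-- `R n = O_p(f n)`: for every `φ` tending to infinity, `R n ≤ φ n * f n` holds with
high probability. -/
def IsBigOInProbability {Ω : ℕ → Type*} [∀ n, MeasurableSpace (Ω n)]
    (P : ∀ n, Measure (Ω n)) (R : ∀ n, Ω n → ℝ) (f : ℕ → ℝ) : Prop :=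
  ∀ φ : ℕ → ℝ, Tendsto φ atTop atTop →
    WithHighProbability P (fun n => {ω | R n ω ≤ φ n * f n})

/-- `X` is an i.i.d. random matrix with Bernoulli(`p`) entries, with values in `{0, 1} ⊆ ℂ`
almost surely. -/
structure IsBernoulliMatrix {Ω : Type*} [MeasurableSpace Ω] (P : Measure Ω) {n : ℕ} (p : ℝ)
    (X : Ω → Matrix (Fin n) (Fin n) ℂ) : Prop where
  measurable : ∀ i j, Measurable (fun ω => X ω i j)
  indep : iIndepFun (fun (e : Fin n × Fin n) ω => X ω e.1 e.2) P
  prob_one : ∀ i j, P {ω | X ω i j = 1} = ENNReal.ofReal p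
  prob_zero : ∀ i j, P {ω | X ω i j = 0} = ENNReal.ofReal (1 - p)

/-- `Y` is an i.i.d. random matrix of (complex) weights with mean zero and unit variance. -/
structure IsWeightMatrix {Ω : Type*} [MeasurableSpace Ω] (P : Measure Ω) {n : ℕ}
    (Y : Ω → Matrix (Fin n) (Fin n) ℂ) : Prop where
  measurable : ∀ i j, Measurable (fun ω => Y ω i j)
  indep : iIndepFun (fun (e : Fin n × Fin n) ω => Y ω e.1 e.2) P
  identDistrib : ∀ i j i' j', IdentDistrib (fun ω => Y ω i j) (fun ω => Y ω i' j') P P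
  integrable_sq : ∀ i j, Integrable (fun ω => ‖Y ω i j‖ ^ 2) P
  mean_zero : ∀ i j, ∫ ω, Y ω i j ∂P = 0
  unit_variance : ∀ i j, ∫ ω, ‖Y ω i j‖ ^ 2 ∂P = 1

/-- The spectral radius `ρ(A)`: the largest modulus of a complex eigenvalue of `A`.
The supremum `spectralRadius` is finite for matrices, as the spectrum is finite. -/
noncomputable def matrixSpectralRadius {n : ℕ} (A : Matrix (Fin n) (Fin n) ℂ) : ℝ :=
  (spectralRadius ℂ A).toReal

/-! Expand `det (1 + t • Z)` in powers of `t`: the coefficient of `t ^ k` is the sum of the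
principal minors of order `k`. It is a signed sum of at most `n ^ k` square-free monomials with
distinct position sets. Independence and the centring of `Y` make these monomials orthogonal, each
with second moment `(d / n) ^ k`, so the coefficient has second moment at most `d ^ k ≤ 1`
(`integral_norm_sq_principalMinorSum`). An eigenvalue `z` with `‖z‖ ≥ r` annihilates the determinant
at `t = -z⁻¹`, which forces the coefficients of order `k ≥ 1`, weighted by `r⁻¹ ^ k`, to have
absolute sum at least 1 (`one_le_sum_of_mem_spectrum`). By Markov this has probability at most `∑
r⁻¹ ^ k = (r - 1)⁻¹`, uniformly in `n`; then `r = φ n`. -/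

open scoped ComplexConjugate

/-! ### Determinant expansion and eigenvalues -/

section Determinant

variable {m : Type*} [DecidableEq m]

/-- The matrix positions `(σ i, i)` with `i ∈ S`. -/
def permPositions (p : Finset m × Equiv.Perm m) : Finset (m × m) :=
  p.1.image fun i => (p.2 i, i)

lemma card_permPositions (p : Finset m × Equiv.Perm m) :
    (permPositions p).card = p.1.card :=
  Finset.card_image_of_injective _ fun _ _ h => (Prod.ext_iff.1 h).2

lemma prod_permPositions {R : Type*} [CommMonoid R] (p : Finset m × Equiv.Perm m)
    (f : m × m → R) : ∏ e ∈ permPositions p, f e = ∏ i ∈ p.1, f (p.2 i, i) :=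
  Finset.prod_image fun _ _ _ _ h => (Prod.ext_iff.1 h).2

variable [Fintype m]

/-- The pairs of a set of `k` indices and a permutation supported in it. -/
def supportedPerms (m : Type*) [Fintype m] [DecidableEq m] (k : ℕ) :
    Finset (Finset m × Equiv.Perm m) :=
  Finset.univ.filter fun p => p.1.card = k ∧ ∀ i ∉ p.1, p.2 i = i

/-- The columns of the positions recover the index set, the rows recover the permutation on it, and
elsewhere the permutation is the identity. Hence different terms of a minor sum are different
monomials. -/
lemma permPositions_injOn (k : ℕ) :
    Set.InjOn permPositions (supportedPerms m k : Set (Finset m × Equiv.Perm m)) := by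
  rintro ⟨S, σ⟩ hp ⟨T, τ⟩ hq h
  simp only [supportedPerms, Finset.coe_filter, Finset.mem_univ, true_and, Set.mem_ofPred_eq]
    at hp hq
  have key : ∀ a i, (i ∈ S ∧ σ i = a) ↔ (i ∈ T ∧ τ i = a) := fun a i => by
    have := Finset.ext_iff.1 h (a, i)
    simpa [permPositions] using this
  have hST : S = T := by
    ext i
    exact ⟨fun hi => ((key _ i).1 ⟨hi, rfl⟩).1, fun hi => ((key _ i).2 ⟨hi, rfl⟩).1⟩
  subst hST
  congr 1
  ext i
  by_cases hi : i ∈ S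
  · exact ((key _ i).1 ⟨hi, rfl⟩).2.symm
  · rw [hp.2 i hi, hq.2 i hi]

/-- The sum of the principal minors of order `k`. -/
def principalMinorSum (M : Matrix m m ℂ) (k : ℕ) : ℂ :=
  ∑ p ∈ supportedPerms m k, ((Equiv.Perm.sign p.2 : ℤ) : ℂ) * ∏ e ∈ permPositions p, M e.1 e.2

lemma principalMinorSum_zero (M : Matrix m m ℂ) : principalMinorSum M 0 = 1 := by
  have : supportedPerms m 0 = {(∅, 1)} := by
    ext ⟨S, σ⟩
    simp only [supportedPerms, Finset.mem_filter, Finset.mem_univ, true_and,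
      Finset.card_eq_zero, Finset.mem_singleton, Prod.mk.injEq]
    constructor
    · rintro ⟨rfl, h⟩
      exact ⟨rfl, Equiv.ext fun i => h i (by simp)⟩
    · rintro ⟨rfl, rfl⟩
      simp
  simp [principalMinorSum, this, permPositions]

/-- In each Leibniz term, `S` collects the columns where the factor from `t • M` is chosen. The
identity factors off `S` survive only if the permutation fixes every index there. -/
lemma det_one_add_smul_eq_sum (t : ℂ) (M : Matrix m m ℂ) :
    (1 + t • M).det = ∑ k ∈ Finset.range (Fintype.card m + 1), t ^ k * principalMinorSum M k := by
  have h1 : (1 + t • M).det = ∑ p : Finset m × Equiv.Perm m, if ∀ i ∉ p.1, p.2 i = i then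
      t ^ p.1.card * (((Equiv.Perm.sign p.2 : ℤ) : ℂ) * ∏ e ∈ permPositions p, M e.1 e.2)
      else 0 := by
    rw [Matrix.det_apply', Fintype.sum_prod_type_right]
    refine Finset.sum_congr rfl fun σ _ => ?_
    simp only [Matrix.add_apply, Matrix.smul_apply, smul_eq_mul, add_comm ((1 : Matrix m m ℂ) _ _)]
    rw [Finset.prod_add, Finset.mul_sum, Finset.powerset_univ]
    refine Finset.sum_congr rfl fun S _ => ?_
    rw [prod_permPositions, Finset.prod_mul_distrib, Finset.prod_const]
    split_ifs with h
    · rw [Finset.prod_eq_one (s := Finset.univ \ S)]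
      · ring
      · intro i hi
        rw [h i (by simpa using hi), Matrix.one_apply_eq]
    · push Not at h
      obtain ⟨i, hi, hne⟩ := h
      have h0 : ∏ i ∈ Finset.univ \ S, (1 : Matrix m m ℂ) (σ i) i = 0 :=
        Finset.prod_eq_zero (i := i) (by simpa using hi) (Matrix.one_apply_ne hne)
      rw [h0, mul_zero, mul_zero]
  rw [h1, ← Finset.sum_filter, ← Finset.sum_fiberwise_of_maps_to
    (g := fun p : Finset m × Equiv.Perm m => p.1.card) (t := Finset.range (Fintype.card m + 1))
    fun p _ => Finset.mem_range.2 (Nat.lt_succ_of_le p.1.card_le_univ)]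
  refine Finset.sum_congr rfl fun k _ => ?_
  rw [principalMinorSum, Finset.mul_sum]
  refine Finset.sum_congr ?_ fun p hp => ?_
  · ext p
    simp [supportedPerms, and_comm]
  · simp only [supportedPerms, Finset.mem_filter] at hp
    rw [hp.2.1]

lemma card_supportedPerms (k : ℕ) :
    (supportedPerms m k).card ≤ Fintype.card m ^ k := by
  have : supportedPerms m k = (Finset.powersetCard k Finset.univ).biUnion fun S =>
      (Finset.univ.filter fun σ : Equiv.Perm m => ∀ i ∉ S, σ i = i).map
        ⟨fun σ => (S, σ), fun _ _ h => (Prod.ext_iff.1 h).2⟩ := by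
    ext ⟨S, σ⟩
    simp only [supportedPerms, Finset.mem_filter, Finset.mem_univ, true_and, Finset.mem_biUnion,
      Finset.mem_powersetCard, Finset.subset_univ, Finset.mem_map]
    constructor
    · rintro ⟨h1, h2⟩
      exact ⟨S, h1, σ, h2, rfl⟩
    · rintro ⟨T, h1, τ, h2, h⟩
      obtain ⟨rfl, rfl⟩ := Prod.mk.inj h
      exact ⟨h1, h2⟩
  rw [this]
  refine Finset.card_biUnion_le.trans ?_
  have hS : ∀ S ∈ Finset.powersetCard k (Finset.univ : Finset m),
      ((Finset.univ.filter fun σ : Equiv.Perm m => ∀ i ∉ S, σ i = i).map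
        ⟨fun σ => (S, σ), fun _ _ h => (Prod.ext_iff.1 h).2⟩ :
        Finset (Finset m × Equiv.Perm m)).card = k.factorial := by
    -- Permutations fixing the complement of `S` are the permutations of `S`; the total is then `k!
    -- * choose n k`, a descending factorial.
    intro S hS
    rw [Finset.card_map, ← Fintype.card_subtype,
      ← Fintype.card_congr (Equiv.Perm.subtypeEquivSubtypePerm (· ∈ S)), Fintype.card_perm,
      Fintype.card_coe, (Finset.mem_powersetCard.1 hS).2]
  rw [Finset.sum_congr rfl hS, Finset.sum_const, Finset.card_powersetCard, Finset.card_univ,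
    smul_eq_mul, mul_comm, ← Nat.descFactorial_eq_factorial_mul_choose]
  exact Nat.descFactorial_le_pow _ _

lemma one_le_sum_of_mem_spectrum {n : ℕ} {M : Matrix (Fin n) (Fin n) ℂ} {z : ℂ} {r : ℝ}
    (hr : 0 < r) (hz : z ∈ spectrum ℂ M) (hrz : r ≤ ‖z‖) :
    1 ≤ ∑ k ∈ Finset.range n, r⁻¹ ^ (k + 1) * ‖principalMinorSum M (k + 1)‖ := by
  have hz0 : z ≠ 0 := norm_pos_iff.1 (hr.trans_le hrz)
  have hdet : (1 + (-z⁻¹) • M).det = 0 := by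
    rw [spectrum.mem_iff, Matrix.isUnit_iff_isUnit_det, isUnit_iff_ne_zero, not_not] at hz
    have : (1 + (-z⁻¹) • M) = z⁻¹ • (algebraMap ℂ (Matrix (Fin n) (Fin n) ℂ) z - M) := by
      rw [smul_sub, Algebra.algebraMap_eq_smul_one, smul_smul, inv_mul_cancel₀ hz0, one_smul,
        neg_smul, sub_eq_add_neg]
    rw [this, Matrix.det_smul, hz, mul_zero]
  rw [det_one_add_smul_eq_sum, Fintype.card_fin, Finset.sum_range_succ', principalMinorSum_zero,
    pow_zero, mul_one, add_eq_zero_iff_eq_neg] at hdet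
  calc (1 : ℝ) = ‖∑ k ∈ Finset.range n, (-z⁻¹) ^ (k + 1) * principalMinorSum M (k + 1)‖ := by
        rw [hdet]; simp
    _ ≤ ∑ k ∈ Finset.range n, ‖(-z⁻¹) ^ (k + 1) * principalMinorSum M (k + 1)‖ := norm_sum_le _ _
    _ ≤ _ := by
        refine Finset.sum_le_sum fun k _ => ?_
        rw [norm_mul, norm_pow, norm_neg, norm_inv]
        gcongr

lemma matrixSpectralRadius_le_of_sum_lt_one {n : ℕ} {M : Matrix (Fin n) (Fin n) ℂ} {r : ℝ}
    (hr : 0 < r)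
    (h : ∑ k ∈ Finset.range n, r⁻¹ ^ (k + 1) * ‖principalMinorSum M (k + 1)‖ < 1) :
    matrixSpectralRadius M ≤ r := by
  refine ENNReal.toReal_le_of_le_ofReal hr.le (iSup₂_le fun z hz => ?_)
  rw [← enorm_eq_nnnorm, ← ofReal_norm]
  refine ENNReal.ofReal_le_ofReal (le_of_not_gt fun hlt => ?_)
  exact absurd (one_le_sum_of_mem_spectrum hr hz hlt.le) (not_le.2 h)

end Determinant

/-! ### Orthogonality of monomials in independent variables -/

section Monomials

variable {Ω ι : Type*} [MeasurableSpace Ω] {P : Measure Ω}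

lemma ProbabilityTheory.iIndepFun.integrable_finset_prod {f : ι → Ω → ℂ} (hf : iIndepFun f P)
    (hm : ∀ i, Measurable (f i)) (hi : ∀ i, Integrable (f i) P) (s : Finset ι) :
    Integrable (∏ i ∈ s, f i) P := by
  have : IsProbabilityMeasure P := hf.isProbabilityMeasure
  classical
  induction s using Finset.induction_on with
  | empty => exact integrable_const (1 : ℂ)
  | insert j s hj ih =>
    rw [Finset.prod_insert hj]
    exact (hf.indepFun_finsetProd_of_notMem hm hj).symm.integrable_mul (hi j) ih

variable [DecidableEq ι]

/-- The factor contributed by one variable to the product of the monomial of `E` with the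
conjugate of the monomial of `F`. -/
noncomputable def crossFactor (E F : Finset ι) (e : ι) (x : ℂ) : ℂ :=
  (if e ∈ E then x else 1) * conj (if e ∈ F then x else 1)

lemma measurable_crossFactor (E F : Finset ι) (e : ι) : Measurable (crossFactor E F e) := by
  unfold crossFactor
  split_ifs <;> fun_prop

lemma integrable_crossFactor [IsFiniteMeasure P] (E F : Finset ι) (e : ι) {f : Ω → ℂ}
    (hf : MemLp f 2 P) : Integrable (fun ω => crossFactor E F e (f ω)) P := by
  have h1 : ∀ s : Finset ι, MemLp (fun ω => if e ∈ s then f ω else 1) 2 P := fun s => by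
    split_ifs
    exacts [hf, memLp_const 1]
  exact (h1 E).integrable_mul (h1 F).star

/-- The second moment of a combination of monomials that are orthogonal with second moments
`v ^ E.card`. -/
lemma integral_norm_sq_sum {κ : Type*} (I : Finset κ) (s : κ → Finset ι) (hs : Set.InjOn s I)
    (g : Finset ι → Ω → ℂ) (v : ℝ) (a : κ → ℂ) (k : ℕ) (ha : ∀ p ∈ I, ‖a p‖ = 1)
    (hk : ∀ p ∈ I, (s p).card = k)
    (hint : ∀ E F, Integrable (fun ω => g E ω * conj (g F ω)) P)
    (hg : ∀ E F, ∫ ω, g E ω * conj (g F ω) ∂P = if E = F then (v : ℂ) ^ E.card else 0) :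
    Integrable (fun ω => ‖∑ p ∈ I, a p * g (s p) ω‖ ^ 2) P ∧
      ∫ ω, ‖∑ p ∈ I, a p * g (s p) ω‖ ^ 2 ∂P = I.card * v ^ k := by
  have hexp : ∀ ω, ((‖∑ p ∈ I, a p * g (s p) ω‖ ^ 2 : ℝ) : ℂ) =
      ∑ p ∈ I, ∑ q ∈ I, a p * conj (a q) * (g (s p) ω * conj (g (s q) ω)) := fun ω => by
    rw [Complex.ofReal_pow, ← Complex.mul_conj', map_sum, Finset.sum_mul_sum]
    refine Finset.sum_congr rfl fun p _ => Finset.sum_congr rfl fun q _ => ?_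
    rw [map_mul]
    ring
  have hI : Integrable (fun ω => ((‖∑ p ∈ I, a p * g (s p) ω‖ ^ 2 : ℝ) : ℂ)) P := by
    simp only [hexp]
    exact integrable_finsetSum _ fun p _ => integrable_finsetSum _ fun q _ =>
      (hint _ _).const_mul _
  refine ⟨hI.re, ?_⟩
  apply Complex.ofReal_injective
  rw [← integral_complex_ofReal]
  simp only [hexp]
  rw [integral_finsetSum _ fun p _ => integrable_finsetSum _ fun q _ =>
      (hint _ _).const_mul _]
  -- Only `q = p` contributes, because `s` is injective on `I`.
  have : ∀ p ∈ I, ∫ ω, ∑ q ∈ I, a p * conj (a q) * (g (s p) ω * conj (g (s q) ω)) ∂P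
      = (v : ℂ) ^ k := by
    intro p hp
    rw [integral_finsetSum _ fun q _ => (hint _ _).const_mul _, Finset.sum_eq_single_of_mem p hp]
    · rw [integral_const_mul, hg, if_pos rfl, hk p hp, Complex.mul_conj', ha p hp]
      simp
    · intro q hq hqp
      rw [integral_const_mul, hg, if_neg fun h => hqp (hs hp hq h).symm, mul_zero]
  rw [Finset.sum_congr rfl this]
  simp

variable [Fintype ι]

/-- Padding with ones gives a single product over all indices, with one factor per variable, so that
independence applies. -/
lemma prod_mul_conj_prod (E F : Finset ι) (x : ι → ℂ) :
    (∏ e ∈ E, x e) * conj (∏ e ∈ F, x e) = ∏ e, crossFactor E F e (x e) := by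
  simp only [crossFactor, Finset.prod_mul_distrib, ← map_prod, Finset.prod_ite_mem,
    Finset.univ_inter]

lemma integrable_prod_mul_conj_prod [IsProbabilityMeasure P] {f : ι → Ω → ℂ} (hf : iIndepFun f P)
    (hm : ∀ i, Measurable (f i)) (hi : ∀ i, MemLp (f i) 2 P) (E F : Finset ι) :
    Integrable (fun ω => (∏ e ∈ E, f e ω) * conj (∏ e ∈ F, f e ω)) P := by
  simp only [prod_mul_conj_prod]
  have := (hf.comp _ (measurable_crossFactor E F)).integrable_finset_prod
    (fun i => (measurable_crossFactor E F i).comp (hm i))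
    (fun i => integrable_crossFactor E F i (hi i)) Finset.univ
  convert this using 1
  ext ω
  simp

lemma integral_prod_mul_conj_prod {f : ι → Ω → ℂ} (hf : iIndepFun f P)
    (hm : ∀ i, Measurable (f i)) (E F : Finset ι) :
    ∫ ω, (∏ e ∈ E, f e ω) * conj (∏ e ∈ F, f e ω) ∂P =
      ∏ e, ∫ ω, crossFactor E F e (f e ω) ∂P := by
  simp only [prod_mul_conj_prod]
  exact hf.integral_fun_prod_comp (fun i => (hm i).aemeasurable)
    fun i => (measurable_crossFactor E F i).aestronglyMeasurable

lemma integral_prod_mul_conj_prod_self [IsProbabilityMeasure P] {f : ι → Ω → ℂ}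
    (hf : iIndepFun f P) (hm : ∀ i, Measurable (f i)) {v : ℝ}
    (hv : ∀ i, ∫ ω, f i ω * conj (f i ω) ∂P = v) (E : Finset ι) :
    ∫ ω, (∏ e ∈ E, f e ω) * conj (∏ e ∈ E, f e ω) ∂P = (v : ℂ) ^ E.card := by
  rw [integral_prod_mul_conj_prod hf hm, ← Finset.prod_const, ← Finset.univ_inter E,
    ← Finset.prod_ite_mem]
  refine Finset.prod_congr rfl fun e _ => ?_
  by_cases he : e ∈ E <;> simp [crossFactor, he, hv]

lemma integral_prod_mul_conj_prod_of_ne {f : ι → Ω → ℂ}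
    (hf : iIndepFun f P) (hm : ∀ i, Measurable (f i)) (h0 : ∀ i, ∫ ω, f i ω ∂P = 0)
    {E F : Finset ι} (hEF : E ≠ F) :
    ∫ ω, (∏ e ∈ E, f e ω) * conj (∏ e ∈ F, f e ω) ∂P = 0 := by
  rw [integral_prod_mul_conj_prod hf hm]
  -- An index in exactly one of the two sets contributes a mean, or its conjugate, which is zero.
  obtain ⟨e, he⟩ : ∃ e, ¬ (e ∈ E ↔ e ∈ F) := by
    by_contra! h
    exact hEF (Finset.ext h)
  refine Finset.prod_eq_zero (Finset.mem_univ e) ?_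
  by_cases heE : e ∈ E <;> by_cases heF : e ∈ F
  · simp [heE, heF] at he
  · simp [crossFactor, heE, heF, h0]
  · simp only [crossFactor, heE, heF, if_true, if_false, one_mul]
    rw [integral_conj, h0, map_zero]
  · simp [heE, heF] at he

end Monomials

/-! ### Second moments of the principal minor sums -/

section RandomMatrix

variable {Ω : Type*} [MeasurableSpace Ω] {P : Measure Ω} {n : ℕ}
  {p : ℝ} {X Y : Ω → Matrix (Fin n) (Fin n) ℂ}

lemma IsWeightMatrix.memLp (hY : IsWeightMatrix P Y) (i j : Fin n) :
    MemLp (fun ω => Y ω i j) 2 P :=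
  (memLp_two_iff_integrable_sq_norm (hY.measurable i j).aestronglyMeasurable).2
    (hY.integrable_sq i j)

lemma IsWeightMatrix.integral_mul_conj (hY : IsWeightMatrix P Y) (i j : Fin n) :
    ∫ ω, Y ω i j * conj (Y ω i j) ∂P = (1 : ℝ) := by
  simp only [Complex.mul_conj']
  rw [← hY.unit_variance i j, ← integral_complex_ofReal]
  simp

lemma measurable_principalMinorSum {M : Ω → Matrix (Fin n) (Fin n) ℂ}
    (hM : ∀ i j, Measurable fun ω => M ω i j) (k : ℕ) :
    Measurable fun ω => principalMinorSum (M ω) k :=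
  Finset.measurable_fun_sum _ fun _ _ =>
    (Finset.measurable_fun_prod _ fun e _ => hM e.1 e.2).const_mul _

variable [IsProbabilityMeasure P]

lemma IsBernoulliMatrix.ae_eq_one_or_zero (hX : IsBernoulliMatrix P p X) (hp0 : 0 ≤ p)
    (hp1 : p ≤ 1) (i j : Fin n) : ∀ᵐ ω ∂P, X ω i j = 1 ∨ X ω i j = 0 := by
  have hm (c : ℂ) : MeasurableSet {ω | X ω i j = c} :=
    hX.measurable i j (measurableSet_singleton c)
  have hd : Disjoint {ω | X ω i j = 1} {ω | X ω i j = 0} := by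
    rw [Set.disjoint_left]
    intro ω (h1 : X ω i j = 1) (h0 : X ω i j = 0)
    exact one_ne_zero (h1.symm.trans h0)
  refine (prob_compl_eq_zero_iff ((hm 1).union (hm 0))).2 ?_
  rw [measure_union hd (hm 0), hX.prob_one, hX.prob_zero, ← ENNReal.ofReal_add hp0 (by linarith)]
  simp

lemma IsBernoulliMatrix.memLp (hX : IsBernoulliMatrix P p X) (hp0 : 0 ≤ p)
    (hp1 : p ≤ 1) (i j : Fin n) : MemLp (fun ω => X ω i j) 2 P := by
  refine MemLp.of_bound (hX.measurable i j).aestronglyMeasurable 1 ?_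
  filter_upwards [hX.ae_eq_one_or_zero hp0 hp1 i j] with ω hω
  rcases hω with h | h <;> simp [h]

lemma IsBernoulliMatrix.integral_mul_conj (hX : IsBernoulliMatrix P p X) (hp0 : 0 ≤ p)
    (hp1 : p ≤ 1) (i j : Fin n) : ∫ ω, X ω i j * conj (X ω i j) ∂P = p := by
  have hm : MeasurableSet {ω | X ω i j = 1} := hX.measurable i j (measurableSet_singleton 1)
  have : (fun ω => X ω i j * conj (X ω i j)) =ᵐ[P] {ω | X ω i j = 1}.indicator fun _ => 1 := by
    filter_upwards [hX.ae_eq_one_or_zero hp0 hp1 i j] with ω hω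
    rcases hω with h | h <;> simp [h, Set.indicator]
  rw [integral_congr_ae this, integral_indicator_const _ hm, Measure.real, hX.prob_one,
    ENNReal.toReal_ofReal hp0]
  simp

/-- The expectation splits into an `X` part and a `Y` part. Orthogonality comes from `Y` alone,
since `X` is not centred; on the diagonal `X` supplies `p ^ k` and `Y` supplies 1. -/
lemma integral_norm_sq_principalMinorSum (hX : IsBernoulliMatrix P p X) (hp0 : 0 ≤ p)
    (hp1 : p ≤ 1) (hY : IsWeightMatrix P Y)
    (hXY : IndepFun (fun ω (e : Fin n × Fin n) => X ω e.1 e.2)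
      (fun ω (e : Fin n × Fin n) => Y ω e.1 e.2) P) (k : ℕ) :
    Integrable (fun ω => ‖principalMinorSum (X ω ⊙ Y ω) k‖ ^ 2) P ∧
      ∫ ω, ‖principalMinorSum (X ω ⊙ Y ω) k‖ ^ 2 ∂P =
        (supportedPerms (Fin n) k).card * p ^ k := by
  have hsplit : ∀ (E F : Finset (Fin n × Fin n)) ω,
      (∏ e ∈ E, (X ω ⊙ Y ω) e.1 e.2) * conj (∏ e ∈ F, (X ω ⊙ Y ω) e.1 e.2) =
      ((∏ e ∈ E, X ω e.1 e.2) * conj (∏ e ∈ F, X ω e.1 e.2)) *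
        ((∏ e ∈ E, Y ω e.1 e.2) * conj (∏ e ∈ F, Y ω e.1 e.2)) := fun E F ω => by
    simp only [Matrix.hadamard_apply, Finset.prod_mul_distrib, map_mul]
    ring
  have hmeas (E F : Finset (Fin n × Fin n)) : Measurable fun x : Fin n × Fin n → ℂ =>
      (∏ e ∈ E, x e) * conj (∏ e ∈ F, x e) := by
    have h (E : Finset (Fin n × Fin n)) : Measurable fun x : Fin n × Fin n → ℂ => ∏ e ∈ E, x e :=
      Finset.measurable_fun_prod _ fun e _ => measurable_pi_apply e
    have := h E
    have := h F
    fun_prop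
  have hind (E F : Finset (Fin n × Fin n)) := hXY.comp (hmeas E F) (hmeas E F)
  have hXm : ∀ e : Fin n × Fin n, Measurable fun ω => X ω e.1 e.2 := fun e => hX.measurable _ _
  have hYm : ∀ e : Fin n × Fin n, Measurable fun ω => Y ω e.1 e.2 := fun e => hY.measurable _ _
  have hXi (E F : Finset (Fin n × Fin n)) := integrable_prod_mul_conj_prod hX.indep hXm
    (fun e => hX.memLp hp0 hp1 e.1 e.2) E F
  have hYi (E F : Finset (Fin n × Fin n)) := integrable_prod_mul_conj_prod hY.indep hYm
    (fun e => hY.memLp e.1 e.2) E F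
  refine integral_norm_sq_sum (supportedPerms (Fin n) k) permPositions (permPositions_injOn k)
    (fun E ω => ∏ e ∈ E, (X ω ⊙ Y ω) e.1 e.2) p (fun q => ((Equiv.Perm.sign q.2 : ℤ) : ℂ)) k
    (fun q _ => ?_) (fun q hq => ?_) (fun E F => ?_) (fun E F => ?_)
  · rcases Int.units_eq_one_or (Equiv.Perm.sign q.2) with h | h <;> simp [h]
  · rw [card_permPositions]
    simp only [supportedPerms, Finset.mem_filter] at hq
    exact hq.2.1
  · simp only [hsplit]
    exact (hind E F).integrable_mul (hXi E F) (hYi E F)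
  · simp only [hsplit]
    refine ((hind E F).integral_fun_mul_eq_mul_integral (hXi E F).1 (hYi E F).1).trans ?_
    simp only [Function.comp_def]
    split_ifs with h
    · subst h
      rw [integral_prod_mul_conj_prod_self hX.indep hXm
          (fun e => hX.integral_mul_conj hp0 hp1 e.1 e.2),
        integral_prod_mul_conj_prod_self hY.indep hYm (fun e => hY.integral_mul_conj e.1 e.2)]
      simp
    · rw [integral_prod_mul_conj_prod_of_ne hY.indep hYm (fun e => hY.mean_zero e.1 e.2) h,
        mul_zero]

end RandomMatrix

/-! ### Markov bound for the spectral radius -/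

section SpectralRadius

variable {Ω : Type*} [MeasurableSpace Ω] {P : Measure Ω} [IsProbabilityMeasure P] {n : ℕ}
  {d : ℝ} {X Y : Ω → Matrix (Fin n) (Fin n) ℂ}

lemma integral_norm_principalMinorSum_le_one (hn : n ≠ 0) (hd0 : 0 ≤ d) (hd1 : d ≤ 1)
    (hX : IsBernoulliMatrix P (d / n) X) (hY : IsWeightMatrix P Y)
    (hXY : IndepFun (fun ω (e : Fin n × Fin n) => X ω e.1 e.2)
      (fun ω (e : Fin n × Fin n) => Y ω e.1 e.2) P) (k : ℕ) :
    Integrable (fun ω => ‖principalMinorSum (X ω ⊙ Y ω) k‖) P ∧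
      ∫ ω, ‖principalMinorSum (X ω ⊙ Y ω) k‖ ∂P ≤ 1 := by
  have hn' : (1 : ℝ) ≤ n := by exact_mod_cast Nat.one_le_iff_ne_zero.2 hn
  obtain ⟨hi, he⟩ := integral_norm_sq_principalMinorSum hX (by positivity)
    (div_le_one_of_le₀ (hd1.trans hn') (by positivity)) hY hXY k
  have hsq : ∫ ω, ‖principalMinorSum (X ω ⊙ Y ω) k‖ ^ 2 ∂P ≤ 1 := by
    rw [he]
    calc ((supportedPerms (Fin n) k).card : ℝ) * (d / n) ^ k ≤ (n : ℝ) ^ k * (d / n) ^ k := by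
          gcongr
          exact_mod_cast (card_supportedPerms k).trans_eq (by rw [Fintype.card_fin])
      _ = d ^ k := by rw [← mul_pow, mul_div_cancel₀ _ (by positivity)]
      _ ≤ 1 := pow_le_one₀ hd0 hd1
  have hm : Measurable fun ω => principalMinorSum (X ω ⊙ Y ω) k :=
    measurable_principalMinorSum (fun i j => (hX.measurable i j).mul (hY.measurable i j)) k
  have hint := ((memLp_two_iff_integrable_sq_norm hm.aestronglyMeasurable).2 hi).integrable
    one_le_two
  refine ⟨hint.norm, ?_⟩
  -- The inequality `x ≤ (1 + x ^ 2) / 2` stands in for Cauchy–Schwarz.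
  calc ∫ ω, ‖principalMinorSum (X ω ⊙ Y ω) k‖ ∂P
      ≤ ∫ ω, (1 + ‖principalMinorSum (X ω ⊙ Y ω) k‖ ^ 2) / 2 ∂P :=
        integral_mono hint.norm (((integrable_const 1).add hi).div_const 2) fun ω => by
          dsimp only
          nlinarith [sq_nonneg (‖principalMinorSum (X ω ⊙ Y ω) k‖ - 1)]
    _ = (1 + ∫ ω, ‖principalMinorSum (X ω ⊙ Y ω) k‖ ^ 2 ∂P) / 2 := by
        rw [integral_div, integral_add (integrable_const 1) hi]
        simp
    _ ≤ 1 := by linarith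

lemma le_measure_matrixSpectralRadius_le (hn : n ≠ 0) (hd0 : 0 ≤ d) (hd1 : d ≤ 1)
    (hX : IsBernoulliMatrix P (d / n) X) (hY : IsWeightMatrix P Y)
    (hXY : IndepFun (fun ω (e : Fin n × Fin n) => X ω e.1 e.2)
      (fun ω (e : Fin n × Fin n) => Y ω e.1 e.2) P) {r : ℝ} (hr : 1 < r) :
    1 - ENNReal.ofReal (r - 1)⁻¹ ≤ P {ω | matrixSpectralRadius (X ω ⊙ Y ω) ≤ r} := by
  have hr0 : 0 < r := one_pos.trans hr
  have hc (k : ℕ) := integral_norm_principalMinorSum_le_one hn hd0 hd1 hX hY hXY k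
  set W : Ω → ℝ := fun ω => ∑ k ∈ Finset.range n,
    r⁻¹ ^ (k + 1) * ‖principalMinorSum (X ω ⊙ Y ω) (k + 1)‖
  have hW : Integrable W P := integrable_finsetSum _ fun k _ => (hc (k + 1)).1.const_mul _
  have hW0 : ∀ ω, 0 ≤ W ω := fun ω => Finset.sum_nonneg fun k _ => by positivity
  have hgeom : HasSum (fun k : ℕ => r⁻¹ ^ (k + 1)) (r - 1)⁻¹ := by
    have := (hasSum_geometric_of_lt_one (inv_nonneg.2 hr0.le) (inv_lt_one_of_one_lt₀ hr)).mul_left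
      r⁻¹
    simp only [← pow_succ'] at this
    rwa [← mul_inv, mul_sub, mul_one, mul_inv_cancel₀ hr0.ne'] at this
  have hEW : ∫ ω, W ω ∂P ≤ (r - 1)⁻¹ := by
    rw [integral_finsetSum _ fun k _ => (hc (k + 1)).1.const_mul _]
    refine (Finset.sum_le_sum fun k _ => ?_).trans
      (sum_le_hasSum (Finset.range n) (fun k _ => by positivity) hgeom)
    rw [integral_const_mul]
    exact mul_le_of_le_one_right (by positivity) (hc (k + 1)).2
  -- Level 1 is the threshold below which no eigenvalue can have modulus above `r`.
  have hmarkov : P {ω | 1 ≤ W ω} ≤ ENNReal.ofReal (r - 1)⁻¹ := by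
    have := mul_meas_ge_le_integral_of_nonneg (Eventually.of_forall hW0) hW 1
    rw [one_mul] at this
    rw [← ofReal_measureReal]
    exact ENNReal.ofReal_le_ofReal (this.trans hEW)
  have hWm : Measurable W := Finset.measurable_fun_sum _ fun k _ =>
    ((measurable_principalMinorSum
      (fun i j => (hX.measurable i j).mul (hY.measurable i j)) (k + 1)).norm).const_mul _
  calc 1 - ENNReal.ofReal (r - 1)⁻¹ ≤ 1 - P {ω | 1 ≤ W ω} := tsub_le_tsub_left hmarkov 1
    _ = P {ω | 1 ≤ W ω}ᶜ := (prob_compl_eq_one_sub (measurableSet_le measurable_const hWm)).symm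
    _ ≤ _ := measure_mono fun ω hω =>
        matrixSpectralRadius_le_of_sum_lt_one hr0 (not_le.1 hω)

end SpectralRadius

theorem mainTheorem2 (d : ℝ) (hd0 : 0 < d) (hd1 : d < 1)
    (Ω : ℕ → Type*) [∀ n, MeasurableSpace (Ω n)]
    (P : ∀ n, Measure (Ω n)) [∀ n, IsProbabilityMeasure (P n)]
    (X Y : ∀ n, Ω n → Matrix (Fin n) (Fin n) ℂ)
    (hX : ∀ n, IsBernoulliMatrix (P n) (d / n) (X n))
    (hY : ∀ n, IsWeightMatrix (P n) (Y n))
    (hXY : ∀ n, IndepFun (fun ω (e : Fin n × Fin n) => X n ω e.1 e.2)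
      (fun ω (e : Fin n × Fin n) => Y n ω e.1 e.2) (P n)) :
    IsBigOInProbability P (fun n ω => matrixSpectralRadius (X n ω ⊙ Y n ω)) (fun _ => 1) := by
  intro φ hφ
  have hlim : Tendsto (fun n => 1 - ENNReal.ofReal (φ n - 1)⁻¹) atTop (𝓝 1) := by
    have h1 : Tendsto (fun n => (φ n - 1)⁻¹) atTop (𝓝 0) :=
      (tendsto_atTop_add_const_right _ (-1) hφ).inv_tendsto_atTop
    have h2 := ENNReal.Tendsto.sub (tendsto_const_nhds (x := (1 : ENNReal)))
      (ENNReal.tendsto_ofReal h1) (Or.inl ENNReal.one_ne_top)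
    simpa using h2
  refine tendsto_of_tendsto_of_tendsto_of_le_of_le' hlim tendsto_const_nhds ?_
    (Eventually.of_forall fun n => prob_le_one)
  filter_upwards [hφ.eventually_gt_atTop 1, eventually_ne_atTop 0] with n hn hn0
  simpa only [mul_one] using
    le_measure_matrixSpectralRadius_le hn0 hd0.le hd1.le (hX n) (hY n) (hXY n) hn
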